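/- Work in the first-order language of arithmetic $\{0,S,+,\times\}$ with equality. A theory $T$ is a set of sentences of this language; $T\vdash\varphi$ means that $\varphi$ is derivable from $T$ in classical first-order logic, and a sentence is true if it holds in the standard model $\mathbb N$. $T$ extends Robinson's arithmetic $Q$ if $T$ proves every axiom of $Q$. $T$ is $\omega$-consistent if there is no formula $\xi(x)$ with only $x$ free such that $T\vdash\exists x\,\neg\xi(x)$ and $T\vdash\xi(\mathbf n)$ for every $n\in\mathbb N$, where $\mathbf n$ is the numeral of $n$. $\Sigma_k$ and $\Pi_k$ refer to the usual arithmetical hierarchy: a $\Pi_3$ sentence is one logically equivalent to a sentence $\forall\vec x\,\exists\vec y\,\forall\vec z\,\delta$, and a $\Sigma_1$ formula is one logically equivalent to a formula $\exists\vec x\,\delta$, where $\delta$ has only bounded quantifiers. Fix a standard Gödel numbering and let $\#\varphi$ be the numeral of the Gödel number of $\varphi$. A provability predicate of $T$ is a $\Sigma_1$ formula $\mathrm{Pr}_T(x)$ such that, for every sentence $\varphi$, $\mathbb N\vDash\mathrm{Pr}_T(\#\varphi)$ if and only if $T\vdash\varphi$ (such a formula exists exactly when the set of theorems of $T$ is recursively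 enumerable). A sentence $G$ is a Gödelian sentence of $T$, with respect to $\mathrm{Pr}_T$, if $T\vdash G\leftrightarrow\neg\mathrm{Pr}_T(\#G)$. Proposition. Let $T$ be an $\omega$-consistent theory extending $Q$. Then: 1. Every $\Pi_3$ sentence provable in $T$ is true in $\mathbb N$. 2. For every provability predicate $\mathrm{Pr}_T$ of $T$, every $\Pi_3$ sentence that is a Gödelian sentence of $T$ with respect to $\mathrm{Pr}_T$ is true in $\mathbb N$. -/

import Mathlib

open FirstOrder FirstOrder.Language

namespace Arith

/-- The function symbols of first-order arithmetic: `0`, successor, `+` and `×`. -/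
inductive Func : ℕ → Type
  | zero : Func 0
  | succ : Func 1
  | add : Func 2
  | mul : Func 2

/-- The language of arithmetic. Equality is a logical symbol; there are no relation symbols. -/
abbrev lang : FirstOrder.Language.{0, 0} where
  Functions := Func
  Relations := fun _ => Empty

/-- Terms with variables among `x₀, …, xₙ₋₁`. -/
abbrev Tm (n : ℕ) : Type := lang.Term (Empty ⊕ Fin n)

/-- Formulas with free variables among `x₀, …, xₙ₋₁`. In `∀' φ` with `φ : Fml (n + 1)` the last
variable `xₙ` of `φ` is bound. -/
abbrev Fml (n : ℕ) : Type := lang.BoundedFormula Empty n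

/-- Sentences: formulas without free variables (this is `lang.Sentence`). -/
abbrev Sen : Type := lang.Sentence

/-- The variable `xᵢ`. -/
def v {n : ℕ} (i : Fin n) : Tm n := Term.var (Sum.inr i)

/-- The term `0`. -/
def zero {n : ℕ} : Tm n := Term.func Func.zero ![]

/-- The term `S t`. -/
def succ {n : ℕ} (t : Tm n) : Tm n := Term.func Func.succ ![t]

/-- The term `s + t`. -/
def add {n : ℕ} (s t : Tm n) : Tm n := Term.func Func.add ![s, t]

/-- The term `s × t`. -/
def mul {n : ℕ} (s t : Tm n) : Tm n := Term.func Func.mul ![s, t]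

/-- The numeral `S (S (… (S 0)))` of `k`. -/
def numeral {n : ℕ} : ℕ → Tm n
  | 0 => zero
  | k + 1 => succ (numeral k)

/-! ### The standard model -/

/-- The standard model `ℕ`. A sentence `φ` is true when `ℕ ⊨ φ`. -/
instance standardModel : lang.Structure ℕ where
  funMap := fun f x => match f with
    | Func.zero => 0
    | Func.succ => x 0 + 1
    | Func.add => x 0 + x 1
    | Func.mul => x 0 * x 1
  RelMap := fun r _ => r.elim

/-! ### Substitution -/

/-- View a term in `n` variables as a term in `n + 1` variables. -/
def Tm.lift {n : ℕ} (t : Tm n) : Tm (n + 1) := t.relabel (Sum.map id Fin.castSucc)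

/-- Simultaneous substitution of `σ i` for `xᵢ` in a term. -/
def Tm.sub {n m : ℕ} (t : Tm n) (σ : Fin n → Tm m) : Tm m := t.subst (Sum.elim Empty.elim σ)

/-- The substitution used below a quantifier: the bound variable is left unchanged. -/
def under {n m : ℕ} (σ : Fin n → Tm m) : Fin (n + 1) → Tm (m + 1) :=
  Fin.snoc (α := fun _ => Tm (m + 1)) (fun i => (σ i).lift) (v (Fin.last m))

/-- Simultaneous (capture-free) substitution of `σ i` for the free variable `xᵢ` in a formula. -/
def Fml.sub : {n : ℕ} → Fml n → {m : ℕ} → (Fin n → Tm m) → Fml m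
  | _, .falsum, _, _ => .falsum
  | _, .equal s t, _, σ => .equal (Tm.sub s σ) (Tm.sub t σ)
  | _, .rel R ts, _, σ => .rel R (fun i => Tm.sub (ts i) σ)
  | _, .imp φ ψ, _, σ => .imp (Fml.sub φ σ) (Fml.sub ψ σ)
  | _, .all φ, _, σ => .all (Fml.sub φ (under σ))

/-- View a formula in `n` variables as a formula in `n + 1` variables. -/
def Fml.lift {n : ℕ} (φ : Fml n) : Fml (n + 1) := φ.sub (fun i => v i.castSucc)

/-- `φ(x₀, …, xₙ₋₁, t)`: substitution of `t` for the last variable of `φ`. -/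
def Fml.inst {n : ℕ} (φ : Fml (n + 1)) (t : Tm n) : Fml n :=
  φ.sub (Fin.snoc (α := fun _ => Tm n) v t)

/-! ### Provability -/

/-- Classical natural deduction for first-order logic with equality. `Prf Γ φ` says that `φ` is
derivable from the assumptions `Γ`; the index `n` bounds the free variables (eigenvariables) in
use. -/
inductive Prf : {n : ℕ} → Set (Fml n) → Fml n → Prop
  | ax {n : ℕ} {Γ : Set (Fml n)} {φ : Fml n} : φ ∈ Γ → Prf Γ φ
  | impI {n : ℕ} {Γ : Set (Fml n)} {φ ψ : Fml n} : Prf (insert φ Γ) ψ → Prf Γ (φ ⟹ ψ)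
  | impE {n : ℕ} {Γ : Set (Fml n)} {φ ψ : Fml n} : Prf Γ (φ ⟹ ψ) → Prf Γ φ → Prf Γ ψ
  | raa {n : ℕ} {Γ : Set (Fml n)} {φ : Fml n} : Prf (insert ∼φ Γ) ⊥ → Prf Γ φ
  | allI {n : ℕ} {Γ : Set (Fml n)} {φ : Fml (n + 1)} : Prf (Fml.lift '' Γ) φ → Prf Γ (∀' φ)
  | allE {n : ℕ} {Γ : Set (Fml n)} {φ : Fml (n + 1)} (t : Tm n) :
      Prf Γ (∀' φ) → Prf Γ (φ.inst t)
  | eqRefl {n : ℕ} {Γ : Set (Fml n)} (t : Tm n) : Prf Γ (t =' t)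
  | eqSubst {n : ℕ} {Γ : Set (Fml n)} (φ : Fml (n + 1)) {s t : Tm n} :
      Prf Γ (s =' t) → Prf Γ (φ.inst s) → Prf Γ (φ.inst t)

/-- `T ⊢ φ` for a set `T` of sentences and a sentence `φ`. -/
def Proves (T : Set Sen) (φ : Sen) : Prop := Prf (n := 0) T φ

/-! ### Robinson's arithmetic -/

/-- The axioms of Robinson's arithmetic `Q`. -/
inductive RobinsonQ : Set Sen
  | succ_inj : RobinsonQ (∀' ∀' ((succ (v 0) =' succ (v 1)) ⟹ (v 0 =' v 1) : Fml 2))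
  | succ_ne_zero : RobinsonQ (∀' (∼(succ (v 0) =' zero) : Fml 1))
  | zero_or_succ : RobinsonQ (∀' (∼(v 0 =' zero) ⟹ ∃' (v 0 =' succ (v 1) : Fml 2) : Fml 1))
  | add_zero : RobinsonQ (∀' (add (v 0) zero =' v 0 : Fml 1))
  | add_succ : RobinsonQ (∀' ∀' (add (v 0) (succ (v 1)) =' succ (add (v 0) (v 1)) : Fml 2))
  | mul_zero : RobinsonQ (∀' (mul (v 0) zero =' zero : Fml 1))
  | mul_succ : RobinsonQ (∀' ∀' (mul (v 0) (succ (v 1)) =' add (mul (v 0) (v 1)) (v 0) : Fml 2))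

/-- `T` extends `S`: every axiom of `S` is a theorem of `T`. -/
def Extends (T S : Set Sen) : Prop := ∀ φ ∈ S, Proves T φ

/-- `φ(k)` for a formula `φ` with one free variable and the numeral of `k`. -/
def Fml.atNum {n : ℕ} (φ : Fml (n + 1)) (k : ℕ) : Fml n := φ.inst (numeral k)

/-- `T` is `ω`-consistent: there is no formula `ξ(x)` such that `T` proves `∃ x, ¬ ξ(x)` and also
proves `ξ(k)` for every natural number `k`. -/
def OmegaConsistent (T : Set Sen) : Prop :=
  ¬ ∃ ξ : Fml 1, Proves T (∃' ∼ξ) ∧ ∀ k : ℕ, Proves T (ξ.atNum k)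

/-! ### The arithmetical hierarchy -/

/-- The formula `xₙ ≤ t`, that is `∃ z, z + xₙ = t`, where `t` does not contain `xₙ`. -/
def lastLe {n : ℕ} (t : Tm n) : Fml (n + 1) :=
  ∃' (add (v (Fin.last (n + 1))) (v (Fin.last n).castSucc) =' t.lift.lift : Fml (n + 2))

/-- `Δ₀` formulas: built from equations by propositional connectives and the bounded quantifiers
`∀ x ≤ t` and `∃ x ≤ t`. -/
inductive IsDelta0 : {n : ℕ} → Fml n → Prop
  | falsum {n : ℕ} : IsDelta0 (⊥ : Fml n)
  | equal {n : ℕ} (s t : Tm n) : IsDelta0 (s =' t)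
  | imp {n : ℕ} {φ ψ : Fml n} : IsDelta0 φ → IsDelta0 ψ → IsDelta0 (φ ⟹ ψ)
  | ball {n : ℕ} (t : Tm n) {φ : Fml (n + 1)} : IsDelta0 φ → IsDelta0 (∀' (lastLe t ⟹ φ))
  | bex {n : ℕ} (t : Tm n) {φ : Fml (n + 1)} : IsDelta0 φ → IsDelta0 (∃' (lastLe t ⊓ φ))

/-- Formulas `∃ x₁ … ∃ xₘ φ`, `m ≥ 0`, with `φ` in the class `C`. -/
inductive ExBlock (C : (n : ℕ) → Fml n → Prop) : (n : ℕ) → Fml n → Prop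
  | base {n : ℕ} {φ : Fml n} : C n φ → ExBlock C n φ
  | ex {n : ℕ} {φ : Fml (n + 1)} : ExBlock C (n + 1) φ → ExBlock C n (∃' φ)

/-- Formulas `∀ x₁ … ∀ xₘ φ`, `m ≥ 0`, with `φ` in the class `C`. -/
inductive AllBlock (C : (n : ℕ) → Fml n → Prop) : (n : ℕ) → Fml n → Prop
  | base {n : ℕ} {φ : Fml n} : C n φ → AllBlock C n φ
  | all {n : ℕ} {φ : Fml (n + 1)} : AllBlock C (n + 1) φ → AllBlock C n (∀' φ)

mutual

/-- Prenex `Σₖ` formulas: `k` alternating blocks of quantifiers, the first existential, in front of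
a `Δ₀` formula. -/
def PrenexSigma : ℕ → (n : ℕ) → Fml n → Prop
  | 0 => fun _ φ => IsDelta0 φ
  | k + 1 => ExBlock (PrenexPi k)

/-- Prenex `Πₖ` formulas: `k` alternating blocks of quantifiers, the first universal, in front of
a `Δ₀` formula. -/
def PrenexPi : ℕ → (n : ℕ) → Fml n → Prop
  | 0 => fun _ φ => IsDelta0 φ
  | k + 1 => AllBlock (PrenexSigma k)

end

/-- `Σₖ` formulas: those logically equivalent to a prenex `Σₖ` formula. -/
def IsSigma (k : ℕ) {n : ℕ} (φ : Fml n) : Prop :=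
  ∃ ψ : Fml n, PrenexSigma k n ψ ∧ Prf ∅ (φ ⇔ ψ)

/-- `Πₖ` formulas: those logically equivalent to a prenex `Πₖ` formula. -/
def IsPi (k : ℕ) {n : ℕ} (φ : Fml n) : Prop :=
  ∃ ψ : Fml n, PrenexPi k n ψ ∧ Prf ∅ (φ ⇔ ψ)

/-! ### Gödel numbers and Gödelian sentences -/

/-- Code numbers of the function symbols. -/
def funcNumber : {l : ℕ} → Func l → ℕ
  | _, .zero => 1
  | _, .succ => 2
  | _, .add => 3
  | _, .mul => 4

/-- Gödel numbers of terms. -/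
def termNumber {n : ℕ} : Tm n → ℕ
  | .var (Sum.inl e) => e.elim
  | .var (Sum.inr i) => Nat.pair 0 i
  | .func f ts =>
      Nat.pair (funcNumber f) (Encodable.encode (List.ofFn fun i => termNumber (ts i)))

/-- Gödel numbers of formulas. -/
def godelNumber : {n : ℕ} → Fml n → ℕ
  | _, .falsum => Nat.pair 0 0
  | _, .equal s t => Nat.pair 1 (Nat.pair (termNumber s) (termNumber t))
  | _, .rel R _ => Empty.elim R
  | _, .imp φ ψ => Nat.pair 2 (Nat.pair (godelNumber φ) (godelNumber ψ))
  | _, .all φ => Nat.pair 3 (godelNumber φ)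

/-- `P(x)` is a provability predicate of `T`: a `Σ₁` formula that expresses provability in `T`, that
is, for every sentence `φ`, `P(#φ)` is true in the standard model exactly if `T ⊢ φ`. (Such a formula
exists precisely when the set of theorems of `T` is recursively enumerable.) -/
def IsProvabilityPredicate (T : Set Sen) (P : Fml 1) : Prop :=
  IsSigma 1 P ∧ ∀ φ : Sen, ℕ ⊨ (P.atNum (godelNumber φ) : Sen) ↔ Proves T φ

/-- `G` is a Gödelian sentence of `T` (with provability predicate `P`): `T` proves
`G ↔ ¬ P(#G)`, where `#G` is the numeral of the Gödel number of `G`. -/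
def IsGodelian (T : Set Sen) (P : Fml 1) (G : Sen) : Prop :=
  Proves T (G ⇔ ∼(P.atNum (godelNumber G)))

end Arith

namespace Arith

/-! ### Substitution calculus -/

section Substitution

variable {n m k : ℕ}

-- A false `Π₃` sentence `∀x ∃y ∀z δ` has a numerical counterexample `a`, so it logically implies
-- `∃y ∀z δ(a, y)`. For every number `b` the sentence `∀z δ(a, b)` is false, hence has a false `Δ₀`
-- instance, which `Q` refutes (`IsDelta0.decided`). Thus a false `Π₃` sentence implies an
-- existential sentence all of whose numerical instances `Q` refutes (`IsPi.exists_refuted`), and an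
-- `ω`-consistent extension of `Q` cannot prove it. A false instance of a `Σ₁` formula has the same
-- property (`IsSigma.exists_refuted`).
--
-- For a Gödelian `G` that is false, `T` does not prove `G` by the first claim, so `Pr(#G)` is false
-- too. But `T` proves `Pr(#G) ∨ G`, hence some `∃x (θ(x) ∨ χ(x))` with every instance refuted,
-- against `ω`-consistency (`OmegaConsistent.not_proves_sup`).
--
-- `ω`-consistency concerns one quantifier, while a block may have several. `RefutesFalse.exBlock`
-- contracts the block by bounding two variables by their sum: `Q` knows the finitely many
-- decompositions of a numeral (`ProvesQ.add_eq_numeral`), so no pairing function is needed.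

theorem Tm.sub_v (σ : Fin n → Tm m) (i : Fin n) : (v i).sub σ = σ i := rfl

theorem Tm.sub_zero (σ : Fin n → Tm m) : (zero : Tm n).sub σ = zero := by
  simp only [zero, Tm.sub, Term.subst]; congr 1; ext i; exact i.elim0

theorem Tm.sub_succ (σ : Fin n → Tm m) (t : Tm n) : (succ t).sub σ = succ (t.sub σ) := by
  simp only [succ, Tm.sub, Term.subst]; congr 1; ext i; fin_cases i; rfl

theorem Tm.sub_add (σ : Fin n → Tm m) (s t : Tm n) :
    (add s t).sub σ = add (s.sub σ) (t.sub σ) := by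
  simp only [add, Tm.sub, Term.subst]; congr 1; ext i; fin_cases i <;> rfl

theorem Tm.sub_mul (σ : Fin n → Tm m) (s t : Tm n) :
    (mul s t).sub σ = mul (s.sub σ) (t.sub σ) := by
  simp only [mul, Tm.sub, Term.subst]; congr 1; ext i; fin_cases i <;> rfl

theorem Tm.sub_numeral (σ : Fin n → Tm m) (k : ℕ) :
    (numeral k : Tm n).sub σ = numeral k := by
  induction k with
  | zero => exact Tm.sub_zero σ
  | succ k ih => rw [numeral, Tm.sub_succ, ih, numeral]

/-- Structural induction on terms of arithmetic. -/
theorem Tm.induction {p : Tm n → Prop} (hv : ∀ i, p (v i)) (h0 : p zero)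
    (hs : ∀ t, p t → p (succ t)) (ha : ∀ s t, p s → p t → p (add s t))
    (hm : ∀ s t, p s → p t → p (mul s t)) (t : Tm n) : p t := by
  induction t with
  | var i =>
    rcases i with e | i
    · exact e.elim
    · exact hv i
  | func f ts ih =>
    cases f with
    | zero => rw [show ts = ![] from Subsingleton.elim _ _]; exact h0
    | succ =>
      rw [show ts = ![ts 0] by ext i; fin_cases i; rfl]; exact hs _ (ih 0)
    | add =>
      rw [show ts = ![ts 0, ts 1] by ext i; fin_cases i <;> rfl]; exact ha _ _ (ih 0) (ih 1)
    | mul =>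
      rw [show ts = ![ts 0, ts 1] by ext i; fin_cases i <;> rfl]; exact hm _ _ (ih 0) (ih 1)

theorem Tm.sub_sub (t : Tm n) (σ : Fin n → Tm m) (τ : Fin m → Tm k) :
    (t.sub σ).sub τ = t.sub fun i => (σ i).sub τ := by
  induction t using Tm.induction with
  | hv i => rfl
  | h0 => simp only [Tm.sub_zero]
  | hs t ih => simp only [Tm.sub_succ, ih]
  | ha s t hs ht => simp only [Tm.sub_add, hs, ht]
  | hm s t hs ht => simp only [Tm.sub_mul, hs, ht]

theorem Tm.sub_id (t : Tm n) : t.sub v = t := by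
  induction t using Tm.induction with
  | hv i => rfl
  | h0 => simp only [Tm.sub_zero]
  | hs t ih => simp only [Tm.sub_succ, ih]
  | ha s t hs ht => simp only [Tm.sub_add, hs, ht]
  | hm s t hs ht => simp only [Tm.sub_mul, hs, ht]

/-- Weakening is defined by relabelling; seen as a substitution, it falls under the composition law
`Tm.sub_sub`. -/
theorem Tm.lift_eq_sub (t : Tm n) : t.lift = t.sub fun i => v i.castSucc := by
  induction t with
  | var i =>
    rcases i with e | i
    · exact e.elim
    · rfl
  | func f ts ih =>
    simp only [Tm.lift, Tm.sub, Term.relabel, Term.subst] at ih ⊢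
    congr 1; ext i; exact ih i

theorem under_castSucc (σ : Fin n → Tm m) (i : Fin n) :
    under σ i.castSucc = (σ i).lift := by simp [under]

theorem under_last (σ : Fin n → Tm m) : under σ (Fin.last n) = v (Fin.last m) := by
  simp [under]

/-- Extend a substitution by a value for the last variable. -/
abbrev extend (σ : Fin n → Tm m) (t : Tm m) : Fin (n + 1) → Tm m :=
  Fin.snoc (α := fun _ => Tm m) σ t

theorem extend_castSucc (σ : Fin n → Tm m) (t : Tm m) (i : Fin n) :
    extend σ t i.castSucc = σ i := by simp [extend]

theorem extend_last (σ : Fin n → Tm m) (t : Tm m) : extend σ t (Fin.last n) = t := by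
  simp [extend]

theorem Tm.lift_sub_under (t : Tm n) (σ : Fin n → Tm m) :
    t.lift.sub (under σ) = (t.sub σ).lift := by
  simp only [Tm.lift_eq_sub, Tm.sub_sub, Tm.sub_v, under_castSucc]

theorem Tm.lift_sub_extend (t : Tm n) (σ : Fin n → Tm m) (s : Tm m) :
    t.lift.sub (extend σ s) = t.sub σ := by
  simp only [Tm.lift_eq_sub, Tm.sub_sub, Tm.sub_v, extend_castSucc]

theorem Tm.lift_numeral (k : ℕ) : (numeral k : Tm n).lift = numeral k := by
  rw [Tm.lift_eq_sub, Tm.sub_numeral]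

theorem Tm.lift_add (s t : Tm n) : (add s t).lift = add s.lift t.lift := by
  simp only [Tm.lift_eq_sub, Tm.sub_add]

theorem Tm.sub_lift (t : Tm n) (σ : Fin n → Tm m) :
    (t.sub fun i => (σ i).lift) = (t.sub σ).lift := by
  simp only [Tm.lift_eq_sub, Tm.sub_sub]

theorem Tm.lift_v (i : Fin n) : (v i).lift = v i.castSucc := rfl

theorem under_sub_under (σ : Fin n → Tm m) (τ : Fin m → Tm k) (i : Fin (n + 1)) :
    (under σ i).sub (under τ) = under (fun j => (σ j).sub τ) i := by
  induction i using Fin.lastCases with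
  | last => simp only [under_last, Tm.sub_v]
  | cast i => simp only [under_castSucc, Tm.lift_sub_under]

theorem under_sub_extend (σ : Fin n → Tm m) (τ : Fin m → Tm k) (t : Tm k) (i : Fin (n + 1)) :
    (under σ i).sub (extend τ t) = extend (fun j => (σ j).sub τ) t i := by
  induction i using Fin.lastCases with
  | last => simp only [under_last, Tm.sub_v, extend_last]
  | cast i => simp only [under_castSucc, Tm.lift_sub_extend, extend_castSucc]

theorem extend_sub (σ : Fin n → Tm m) (t : Tm m) (τ : Fin m → Tm k) (i : Fin (n + 1)) :
    (extend σ t i).sub τ = extend (fun j => (σ j).sub τ) (t.sub τ) i := by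
  induction i using Fin.lastCases with
  | last => simp only [extend_last]
  | cast i => simp only [extend_castSucc]

theorem under_v : under (v : Fin n → Tm n) = v := by
  ext1 i
  induction i using Fin.lastCases with
  | last => rw [under_last]
  | cast i => rw [under_castSucc]; rfl

theorem Fml.sub_equal (σ : Fin n → Tm m) (s t : Tm n) :
    Fml.sub (s =' t) σ = (s.sub σ =' t.sub σ) := rfl

theorem Fml.sub_imp (σ : Fin n → Tm m) (φ ψ : Fml n) :
    Fml.sub (φ ⟹ ψ) σ = (φ.sub σ ⟹ ψ.sub σ) := rfl

theorem Fml.sub_not (σ : Fin n → Tm m) (φ : Fml n) : Fml.sub (∼φ) σ = ∼(φ.sub σ) := rfl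

theorem Fml.sub_inf (σ : Fin n → Tm m) (φ ψ : Fml n) :
    Fml.sub (φ ⊓ ψ) σ = φ.sub σ ⊓ ψ.sub σ := rfl

theorem Fml.sub_all (σ : Fin n → Tm m) (φ : Fml (n + 1)) :
    Fml.sub (∀' φ) σ = ∀' φ.sub (under σ) := rfl

theorem Fml.sub_ex (σ : Fin n → Tm m) (φ : Fml (n + 1)) :
    Fml.sub (∃' φ) σ = ∃' φ.sub (under σ) := rfl

theorem Fml.sub_sub (φ : Fml n) {m k : ℕ} (σ : Fin n → Tm m) (τ : Fin m → Tm k) :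
    (φ.sub σ).sub τ = φ.sub fun i => (σ i).sub τ := by
  induction φ generalizing m k with
  | falsum => rfl
  | equal s t => simp only [Fml.sub, Tm.sub_sub]
  | rel R ts => exact R.elim
  | imp φ ψ hφ hψ => simp only [Fml.sub, hφ, hψ]
  | all φ ih => simp only [Fml.sub, ih, under_sub_under]

theorem Fml.sub_id (φ : Fml n) : φ.sub v = φ := by
  induction φ with
  | falsum => rfl
  | equal s t => simp only [Fml.sub, Tm.sub_id]
  | rel R ts => exact R.elim
  | imp φ ψ hφ hψ => simp only [Fml.sub, hφ, hψ]
  | all φ ih => simp only [Fml.sub, under_v, ih]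

theorem Fml.inst_eq (φ : Fml (n + 1)) (t : Tm n) : φ.inst t = φ.sub (extend v t) := rfl

theorem Fml.lift_equal (s t : Tm n) : Fml.lift (s =' t) = (s.lift =' t.lift) := by
  rw [Fml.lift, Fml.sub_equal, ← Tm.lift_eq_sub, ← Tm.lift_eq_sub]

theorem Fml.lift_imp (φ ψ : Fml n) : Fml.lift (φ ⟹ ψ) = (φ.lift ⟹ ψ.lift) := rfl

theorem Fml.lift_falsum : Fml.lift (⊥ : Fml n) = ⊥ := rfl

theorem Fml.lift_sub_under (φ : Fml n) (σ : Fin n → Tm m) :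
    φ.lift.sub (under σ) = (φ.sub σ).lift := by
  simp only [Fml.lift, Fml.sub_sub, Tm.sub_v, under_castSucc, Tm.lift_eq_sub]

theorem Fml.lift_sub_extend (φ : Fml n) (σ : Fin n → Tm m) (t : Tm m) :
    φ.lift.sub (extend σ t) = φ.sub σ := by
  simp only [Fml.lift, Fml.sub_sub, Tm.sub_v, extend_castSucc]

theorem Fml.sub_under_sub_extend (φ : Fml (n + 1)) (σ : Fin n → Tm m) (τ : Fin m → Tm k)
    (t : Tm k) :
    (φ.sub (under σ)).sub (extend τ t) = φ.sub (extend (fun j => (σ j).sub τ) t) := by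
  simp only [Fml.sub_sub, under_sub_extend]

theorem Fml.sub_under_inst (φ : Fml (n + 1)) (σ : Fin n → Tm m) (t : Tm m) :
    (φ.sub (under σ)).inst t = φ.sub (extend σ t) := by
  simp only [Fml.inst_eq, Fml.sub_under_sub_extend, Tm.sub_id]

theorem Fml.inst_sub (φ : Fml (n + 1)) (t : Tm n) (σ : Fin n → Tm m) :
    (φ.inst t).sub σ = (φ.sub (under σ)).inst (t.sub σ) := by
  rw [Fml.sub_under_inst, Fml.inst_eq, Fml.sub_sub]
  simp only [extend_sub, Tm.sub_v]

theorem Fml.lift_inst (φ : Fml n) (t : Tm n) : φ.lift.inst t = φ := by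
  rw [Fml.inst_eq, Fml.lift_sub_extend, Fml.sub_id]

end Substitution

/-! ### Soundness in the standard model -/

section Semantics

variable {n m : ℕ}

/-- The value of a term in the standard model. -/
def Tm.val (t : Tm n) (a : Fin n → ℕ) : ℕ := t.realize (Sum.elim Empty.elim a)

/-- Truth of a formula in the standard model under an assignment. -/
def Fml.True (φ : Fml n) (a : Fin n → ℕ) : Prop := φ.Realize Empty.elim a

theorem Tm.val_v (a : Fin n → ℕ) (i : Fin n) : (v i).val a = a i := rfl

theorem Tm.val_succ (a : Fin n → ℕ) (t : Tm n) : (succ t).val a = t.val a + 1 := rfl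

theorem Tm.val_add (a : Fin n → ℕ) (s t : Tm n) : (add s t).val a = s.val a + t.val a := rfl

theorem Tm.val_mul (a : Fin n → ℕ) (s t : Tm n) : (mul s t).val a = s.val a * t.val a := rfl

theorem Tm.val_numeral (a : Fin n → ℕ) (k : ℕ) : (numeral k : Tm n).val a = k := by
  induction k with
  | zero => rfl
  | succ k ih => rw [numeral, Tm.val_succ, ih]

theorem Tm.val_sub (t : Tm n) (σ : Fin n → Tm m) (a : Fin m → ℕ) :
    (t.sub σ).val a = t.val fun i => (σ i).val a := by
  induction t using Tm.induction with
  | hv i => rfl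
  | h0 => rfl
  | hs t ih => simp only [Tm.sub_succ, Tm.val_succ, ih]
  | ha s t hs ht => simp only [Tm.sub_add, Tm.val_add, hs, ht]
  | hm s t hs ht => simp only [Tm.sub_mul, Tm.val_mul, hs, ht]

theorem Tm.val_lift (t : Tm n) (a : Fin n → ℕ) (k : ℕ) :
    t.lift.val (Fin.snoc (α := fun _ => ℕ) a k) = t.val a := by
  rw [Tm.lift_eq_sub, Tm.val_sub]; simp [Tm.val_v]

theorem Fml.true_equal (a : Fin n → ℕ) (s t : Tm n) :
    Fml.True (s =' t) a ↔ s.val a = t.val a := Iff.rfl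

theorem Fml.true_imp (a : Fin n → ℕ) (φ ψ : Fml n) :
    Fml.True (φ ⟹ ψ) a ↔ (φ.True a → ψ.True a) := Iff.rfl

theorem Fml.true_all (a : Fin n → ℕ) (φ : Fml (n + 1)) :
    Fml.True (∀' φ) a ↔ ∀ k : ℕ, φ.True (Fin.snoc (α := fun _ => ℕ) a k) := Iff.rfl

theorem Fml.true_ex (a : Fin n → ℕ) (φ : Fml (n + 1)) :
    Fml.True (∃' φ) a ↔ ∃ k : ℕ, φ.True (Fin.snoc (α := fun _ => ℕ) a k) :=
  BoundedFormula.realize_ex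

theorem Fml.true_inf (a : Fin n → ℕ) (φ ψ : Fml n) :
    Fml.True (φ ⊓ ψ) a ↔ φ.True a ∧ ψ.True a := BoundedFormula.realize_inf

theorem Fml.true_iff (a : Fin n → ℕ) (φ ψ : Fml n) :
    Fml.True (φ ⇔ ψ) a ↔ (φ.True a ↔ ψ.True a) := BoundedFormula.realize_iff

theorem Fml.true_sub (φ : Fml n) {m : ℕ} (σ : Fin n → Tm m) (a : Fin m → ℕ) :
    (φ.sub σ).True a ↔ φ.True fun i => (σ i).val a := by
  induction φ generalizing m with
  | falsum => rfl
  | equal s t =>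
    exact (Fml.true_equal _ _ _).trans (by rw [Tm.val_sub, Tm.val_sub]; rfl)
  | rel R ts => exact R.elim
  | imp φ ψ hφ hψ => exact imp_congr (hφ σ a) (hψ σ a)
  | all φ ih =>
    refine forall_congr' fun k => (ih (under σ) _).trans ?_
    rw [Fml.True]
    congr! 1
    ext1 i
    induction i using Fin.lastCases with
    | last => rw [under_last, Tm.val_v]; simp
    | cast i => rw [under_castSucc, Tm.val_lift]; simp

theorem Fml.true_lift (φ : Fml n) (a : Fin n → ℕ) (k : ℕ) :
    φ.lift.True (Fin.snoc (α := fun _ => ℕ) a k) ↔ φ.True a := by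
  rw [Fml.lift, Fml.true_sub]; simp [Tm.val_v]

theorem Fml.true_inst (φ : Fml (n + 1)) (t : Tm n) (a : Fin n → ℕ) :
    (φ.inst t).True a ↔ φ.True (Fin.snoc (α := fun _ => ℕ) a (t.val a)) := by
  rw [Fml.inst_eq, Fml.true_sub]
  congr! 1
  ext1 i
  induction i using Fin.lastCases with
  | last => rw [extend_last]; simp
  | cast i => rw [extend_castSucc, Tm.val_v]; simp

theorem Fml.true_sentence (φ : Sen) (a : Fin 0 → ℕ) : ℕ ⊨ φ ↔ Fml.True (n := 0) φ a := by
  rw [Sentence.Realize, Formula.Realize, Fml.True]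
  congr! 1

/-- Needed because `IsPi` and `IsSigma` allow any formula provably equivalent to a prenex one:
soundness carries falsity over to the prenex form. -/
theorem Prf.sound {Γ : Set (Fml n)} {φ : Fml n} (h : Prf Γ φ) (a : Fin n → ℕ)
    (hΓ : ∀ γ ∈ Γ, γ.True a) : φ.True a := by
  induction h with
  | ax h => exact hΓ _ h
  | impI _ ih =>
    intro h
    exact ih a fun γ hγ => hγ.elim (fun e => e ▸ h) (hΓ γ)
  | impE _ _ ih₁ ih₂ => exact ih₁ a hΓ (ih₂ a hΓ)
  | raa _ ih =>
    by_contra h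
    exact ih a fun γ hγ => hγ.elim (fun e => e ▸ h) (hΓ γ)
  | allI _ ih =>
    intro k
    refine ih _ ?_
    rintro _ ⟨γ, hγ, rfl⟩
    exact (Fml.true_lift γ a k).2 (hΓ γ hγ)
  | allE t _ ih => exact (Fml.true_inst _ _ _).2 (ih a hΓ _)
  | eqRefl t => rfl
  | eqSubst φ _ _ ih₁ ih₂ =>
    have h₁ := (Fml.true_equal _ _ _).1 (ih₁ a hΓ)
    have h₂ := (Fml.true_inst _ _ _).1 (ih₂ a hΓ)
    rw [Fml.true_inst, ← h₁]
    exact h₂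

end Semantics

/-! ### Derived rules -/

section Rules

variable {n m : ℕ} {Γ Δ : Set (Fml n)} {φ ψ χ : Fml n}

theorem Prf.weaken (h : Prf Γ φ) (hΓ : Γ ⊆ Δ) : Prf Δ φ := by
  induction h with
  | ax h => exact .ax (hΓ h)
  | impI _ ih => exact .impI (ih (Set.insert_subset_insert hΓ))
  | impE _ _ ih₁ ih₂ => exact .impE (ih₁ hΓ) (ih₂ hΓ)
  | raa _ ih => exact .raa (ih (Set.insert_subset_insert hΓ))
  | allI _ ih => exact .allI (ih (Set.image_mono hΓ))
  | allE t _ ih => exact .allE t (ih hΓ)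
  | eqRefl t => exact .eqRefl t
  | eqSubst φ _ _ ih₁ ih₂ => exact .eqSubst φ (ih₁ hΓ) (ih₂ hΓ)

theorem Prf.insert (h : Prf Γ φ) (ψ : Fml n) : Prf (insert ψ Γ) φ :=
  h.weaken (Set.subset_insert _ _)

theorem Prf.hyp : Prf (Insert.insert φ Γ) φ := .ax (Set.mem_insert _ _)

theorem Prf.cut (h : Prf (Insert.insert φ Γ) ψ) (hφ : Prf Γ φ) : Prf Γ ψ := .impE (.impI h) hφ

theorem Prf.cut_singleton (h : Prf {φ} ψ) (hφ : Prf Γ φ) : Prf Γ ψ :=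
  (h.weaken (Set.singleton_subset_iff.2 (Set.mem_insert _ _))).cut hφ

/-- Serves both to weaken a derivation by a fresh eigenvariable and to put numerals for its
variables. The quantifier rules go through because substitution commutes with `Fml.lift` and
`Fml.inst`. -/
theorem Prf.sub (h : Prf Γ φ) (σ : Fin n → Tm m) : Prf ((fun γ => Fml.sub γ σ) '' Γ) (φ.sub σ) := by
  induction h generalizing m with
  | ax h => exact .ax (Set.mem_image_of_mem _ h)
  | impI _ ih => exact .impI (by have := ih σ; rwa [Set.image_insert_eq] at this)
  | impE _ _ ih₁ ih₂ => exact .impE (ih₁ σ) (ih₂ σ)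
  | raa _ ih => exact .raa (by have := ih σ; rwa [Set.image_insert_eq] at this)
  | allI _ ih =>
    refine .allI ?_
    have := ih (under σ)
    rw [Set.image_image] at this ⊢
    simpa only [Fml.lift_sub_under] using this
  | allE t _ ih => rw [Fml.inst_sub]; exact .allE _ (ih σ)
  | eqRefl t => exact .eqRefl _
  | eqSubst φ _ _ ih₁ ih₂ =>
    rw [Fml.inst_sub]
    exact .eqSubst _ (ih₁ σ) (by have := ih₂ σ; rwa [Fml.inst_sub] at this)

theorem Prf.lift (h : Prf Γ φ) : Prf (Fml.lift '' Γ) φ.lift := h.sub _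

theorem Prf.exfalso (h : Prf Γ ⊥) : Prf Γ φ := .raa (h.insert _)

theorem Prf.byCases (h₁ : Prf (Insert.insert φ Γ) ψ) (h₂ : Prf (Insert.insert (∼φ) Γ) ψ) :
    Prf Γ ψ := by
  refine .raa (.impE .hyp ((?_ : Prf _ _).cut (φ := ∼φ) ?_))
  · exact h₂.weaken (Set.insert_subset_insert (Set.subset_insert _ _))
  · refine .impI (.impE (Prf.hyp.insert _) (h₁.weaken ?_))
    exact Set.insert_subset_insert (Set.subset_insert _ _)

theorem Prf.notNot (h : Prf Γ φ) : Prf Γ (∼∼φ) := .impI (.impE .hyp (h.insert _))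

theorem Prf.andI (h₁ : Prf Γ φ) (h₂ : Prf Γ ψ) : Prf Γ (φ ⊓ ψ) :=
  .impI (.impE (.impE .hyp (h₁.insert _)) (h₂.insert _))

theorem Prf.andL (h : Prf Γ (φ ⊓ ψ)) : Prf Γ φ :=
  .raa (.impE (h.insert _) (.impI (.exfalso (.impE (Prf.hyp.insert _) .hyp))))

theorem Prf.andR (h : Prf Γ (φ ⊓ ψ)) : Prf Γ ψ :=
  .raa (.impE (h.insert _) (.impI (Prf.hyp.insert _)))

theorem Prf.orL (h : Prf Γ φ) : Prf Γ (φ ⊔ ψ) :=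
  .impI (.exfalso (.impE .hyp (h.insert _)))

theorem Prf.orR (h : Prf Γ ψ) : Prf Γ (φ ⊔ ψ) := .impI (h.insert _)

/-- Merging the instantiation into the ambient substitution keeps goals in the form `φ.sub (extend σ
t)`, to which induction on `φ` applies. -/
theorem Prf.allE_sub {φ : Fml (m + 1)} {σ : Fin m → Tm n} (h : Prf Γ (Fml.sub (∀' φ) σ))
    (t : Tm n) : Prf Γ (φ.sub (extend σ t)) := by
  have := Prf.allE t h
  rwa [Fml.sub_under_inst] at this

theorem Prf.exI {φ : Fml (n + 1)} (t : Tm n) (h : Prf Γ (φ.inst t)) : Prf Γ (∃' φ) :=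
  .impI (.impE (.allE (φ := ∼φ) t .hyp) (h.insert _))

theorem Prf.exI_sub {φ : Fml (m + 1)} {σ : Fin m → Tm n} (t : Tm n)
    (h : Prf Γ (φ.sub (extend σ t))) : Prf Γ (Fml.sub (∃' φ) σ) :=
  .exI t (by rwa [Fml.sub_under_inst])

theorem Prf.exE {φ : Fml (n + 1)} (h : Prf Γ (∃' φ))
    (H : Prf (Insert.insert φ (Fml.lift '' Γ)) ψ.lift) : Prf Γ ψ := by
  refine .raa (.impE (h.insert _) (.allI (.impI ?_)))
  rw [Set.image_insert_eq]
  refine .impE (Prf.hyp.insert _) (H.weaken ?_)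
  exact Set.insert_subset_insert (Set.subset_insert _ _)

theorem extend_castSucc_last :
    extend (fun i : Fin n => v i.castSucc) (v (Fin.last n)) = v := by
  ext1 i
  induction i using Fin.lastCases with
  | last => rw [extend_last]
  | cast i => rw [extend_castSucc]

theorem Prf.exMono {φ ψ : Fml (n + 1)} (h : Prf Γ (∃' φ)) (H : Prf {φ} ψ) : Prf Γ (∃' ψ) := by
  refine h.exE (.exI_sub (v (Fin.last n)) ?_)
  rw [extend_castSucc_last, Fml.sub_id]
  exact H.cut_singleton .hyp

end Rules

/-! ### Equality -/

section Equality

variable {n : ℕ} {Γ : Set (Fml n)} {s t u s' t' : Tm n}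

/-- Leibniz's rule applied to the formula `f(s) = f(x)`, starting from reflexivity at `x = s`. -/
theorem Prf.eq_subst_term (f : Tm (n + 1)) (h : Prf Γ (s =' t)) :
    Prf Γ (f.sub (extend v s) =' f.sub (extend v t)) := by
  have key : ∀ r : Tm n, Fml.inst ((f.sub (extend v s)).lift =' f) r =
      (f.sub (extend v s) =' f.sub (extend v r)) := fun r => by
    rw [Fml.inst_eq, Fml.sub_equal, Tm.lift_sub_extend, Tm.sub_id]
  have := Prf.eqSubst ((f.sub (extend v s)).lift =' f) h (by rw [key]; exact .eqRefl _)
  rwa [key] at this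

theorem Prf.eq_symm (h : Prf Γ (s =' t)) : Prf Γ (t =' s) := by
  have key : ∀ r : Tm n, Fml.inst (v (Fin.last n) =' s.lift) r = (r =' s) := fun r => by
    rw [Fml.inst_eq, Fml.sub_equal, Tm.lift_sub_extend, Tm.sub_id, Tm.sub_v, extend_last]
  have := Prf.eqSubst (v (Fin.last n) =' s.lift) h (by rw [key]; exact .eqRefl _)
  rwa [key] at this

theorem Prf.eq_trans (h₁ : Prf Γ (s =' t)) (h₂ : Prf Γ (t =' u)) : Prf Γ (s =' u) := by
  have key : ∀ r : Tm n, Fml.inst (s.lift =' v (Fin.last n)) r = (s =' r) := fun r => by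
    rw [Fml.inst_eq, Fml.sub_equal, Tm.lift_sub_extend, Tm.sub_id, Tm.sub_v, extend_last]
  have := Prf.eqSubst (s.lift =' v (Fin.last n)) h₂ (by rwa [key])
  rwa [key] at this

theorem Prf.succ_congr (h : Prf Γ (s =' t)) : Prf Γ (succ s =' succ t) := by
  simpa only [Tm.sub_succ, Tm.sub_v, extend_last] using h.eq_subst_term (succ (v (Fin.last n)))

theorem Prf.add_congr (h : Prf Γ (s =' t)) (h' : Prf Γ (s' =' t')) :
    Prf Γ (add s s' =' add t t') := by
  have h₁ := h.eq_subst_term (add (v (Fin.last n)) s'.lift)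
  have h₂ := h'.eq_subst_term (add t.lift (v (Fin.last n)))
  simp only [Tm.sub_add, Tm.sub_v, extend_last, Tm.lift_sub_extend, Tm.sub_id] at h₁ h₂
  exact h₁.eq_trans h₂

theorem Prf.mul_congr (h : Prf Γ (s =' t)) (h' : Prf Γ (s' =' t')) :
    Prf Γ (mul s s' =' mul t t') := by
  have h₁ := h.eq_subst_term (mul (v (Fin.last n)) s'.lift)
  have h₂ := h'.eq_subst_term (mul t.lift (v (Fin.last n)))
  simp only [Tm.sub_mul, Tm.sub_v, extend_last, Tm.lift_sub_extend, Tm.sub_id] at h₁ h₂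
  exact h₁.eq_trans h₂

end Equality

/-! ### Derivations in Robinson's arithmetic -/

section Robinson

variable {n m : ℕ} {Γ : Set (Fml n)}

/-- The assumptions `Γ` derive the axioms of `Q`. -/
def ProvesQ (Γ : Set (Fml n)) : Prop :=
  ∀ φ, RobinsonQ φ → Prf Γ (Fml.sub (n := 0) φ fun i => i.elim0)

theorem ProvesQ.insert (h : ProvesQ Γ) (φ : Fml n) : ProvesQ (insert φ Γ) :=
  fun ψ hψ => (h ψ hψ).insert φ

/-- The axioms are closed, so they survive the passage to a new eigenvariable. -/
theorem ProvesQ.lift (h : ProvesQ Γ) : ProvesQ (Fml.lift '' Γ) := fun ψ hψ => by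
  have := (h ψ hψ).lift
  rw [Fml.lift, Fml.sub_sub] at this
  convert this using 2

theorem ProvesQ.of_extends {T : Set Sen} (h : Extends T RobinsonQ) : ProvesQ (n := 0) T :=
  fun ψ hψ => by
    have := h ψ hψ
    rw [← Fml.sub_id (n := 0) ψ, show (v : Fin 0 → Tm 0) = fun i => i.elim0 from
      Subsingleton.elim _ _] at this
    exact this

namespace ProvesQ

variable {s t : Tm n}

theorem succ_inj (hΓ : ProvesQ Γ) (h : Prf Γ (succ s =' succ t)) : Prf Γ (s =' t) := by
  have := ((hΓ _ .succ_inj).allE_sub s).allE_sub t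
  simp only [Fml.sub_imp, Fml.sub_equal, Tm.sub_succ, Tm.sub_v] at this
  exact this.impE h

theorem succ_ne_zero (hΓ : ProvesQ Γ) (h : Prf Γ (succ s =' zero)) : Prf Γ ⊥ := by
  have := (hΓ _ .succ_ne_zero).allE_sub s
  simp only [Fml.sub_not, Fml.sub_equal, Tm.sub_succ, Tm.sub_v, Tm.sub_zero] at this
  exact this.impE h

theorem zero_or_succ (hΓ : ProvesQ Γ) (h : Prf Γ ∼(s =' zero)) :
    Prf Γ (∃' (s.lift =' succ (v (Fin.last n)))) := by
  have := (hΓ _ .zero_or_succ).allE_sub s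
  simp only [Fml.sub_imp, Fml.sub_not, Fml.sub_ex, Fml.sub_equal, Tm.sub_succ, Tm.sub_v,
    Tm.sub_zero] at this
  exact this.impE h

theorem add_zero (hΓ : ProvesQ Γ) (s : Tm n) : Prf Γ (add s zero =' s) := by
  have := (hΓ _ .add_zero).allE_sub s
  simp only [Fml.sub_equal, Tm.sub_add, Tm.sub_v, Tm.sub_zero] at this
  exact this

theorem add_succ (hΓ : ProvesQ Γ) (s t : Tm n) :
    Prf Γ (add s (succ t) =' succ (add s t)) := by
  have := ((hΓ _ .add_succ).allE_sub s).allE_sub t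
  simp only [Fml.sub_equal, Tm.sub_succ, Tm.sub_add, Tm.sub_v] at this
  exact this

theorem mul_zero (hΓ : ProvesQ Γ) (s : Tm n) : Prf Γ (mul s zero =' zero) := by
  have := (hΓ _ .mul_zero).allE_sub s
  simp only [Fml.sub_equal, Tm.sub_mul, Tm.sub_v, Tm.sub_zero] at this
  exact this

theorem mul_succ (hΓ : ProvesQ Γ) (s t : Tm n) :
    Prf Γ (mul s (succ t) =' add (mul s t) s) := by
  have := ((hΓ _ .mul_succ).allE_sub s).allE_sub t
  simp only [Fml.sub_equal, Tm.sub_succ, Tm.sub_add, Tm.sub_mul, Tm.sub_v] at this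
  exact this

theorem numeral_add (hΓ : ProvesQ Γ) (i j : ℕ) :
    Prf Γ (add (numeral i) (numeral j) =' numeral (i + j)) := by
  induction j with
  | zero => exact hΓ.add_zero _
  | succ j ih => exact (hΓ.add_succ _ _).eq_trans ih.succ_congr

theorem numeral_mul (hΓ : ProvesQ Γ) (i j : ℕ) :
    Prf Γ (mul (numeral i) (numeral j) =' numeral (i * j)) := by
  induction j with
  | zero => exact hΓ.mul_zero _
  | succ j ih =>
    exact (hΓ.mul_succ _ _).eq_trans ((ih.add_congr (.eqRefl _)).eq_trans (hΓ.numeral_add _ _))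

theorem numeral_ne (hΓ : ProvesQ Γ) {i j : ℕ} (hij : i ≠ j)
    (h : Prf Γ (numeral i =' numeral j)) : Prf Γ ⊥ := by
  induction i generalizing j with
  | zero =>
    cases j with
    | zero => exact absurd rfl hij
    | succ j => exact hΓ.succ_ne_zero h.eq_symm
  | succ i ih =>
    cases j with
    | zero => exact hΓ.succ_ne_zero h
    | succ j => exact ih (fun e => hij (by rw [e])) (hΓ.succ_inj h)

/-- In `Q`, a sum equal to a numeral has one of the finitely many standard decompositions. -/
theorem add_eq_numeral {n : ℕ} {Γ : Set (Fml n)} {s t : Tm n} (hΓ : ProvesQ Γ) (k : ℕ)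
    (h : Prf Γ (add s t =' numeral k))
    (H : ∀ i j, i + j = k → Prf Γ (s =' numeral i ⟹ t =' numeral j ⟹ ⊥)) : Prf Γ ⊥ := by
  -- Addition in `Q` recurs on the second summand, so the descent is on `t`: either `t = 0` and `s`
  -- is the numeral, or `t` has a predecessor, a fresh variable, and `k` drops by one. Hence `n`
  -- must vary.
  induction k generalizing n with
  | zero =>
    refine Prf.byCases (φ := t =' zero) ?_ ?_
    · refine (((H 0 0 rfl).insert _).impE ?_).impE .hyp
      exact ((hΓ.insert _).add_zero s).eq_symm.eq_trans
        ((Prf.add_congr (.eqRefl s) Prf.hyp.eq_symm).eq_trans (h.insert _))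
    · refine ((hΓ.insert _).zero_or_succ .hyp).exE ?_
      have h' := ((h.insert (∼(t =' zero))).lift).insert (t.lift =' succ (v (Fin.last n)))
      have hΓ' := (hΓ.insert (∼(t =' zero))).lift.insert (t.lift =' succ (v (Fin.last n)))
      simp only [Fml.lift_equal, Tm.lift_add, Tm.lift_numeral] at h'
      exact hΓ'.succ_ne_zero ((hΓ'.add_succ s.lift _).eq_symm.eq_trans
        ((Prf.add_congr (.eqRefl _) Prf.hyp.eq_symm).eq_trans h'))
  | succ k ih =>
    refine Prf.byCases (φ := t =' zero) ?_ ?_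
    · refine (((H (k + 1) 0 rfl).insert _).impE ?_).impE .hyp
      exact ((hΓ.insert _).add_zero s).eq_symm.eq_trans
        ((Prf.add_congr (.eqRefl s) Prf.hyp.eq_symm).eq_trans (h.insert _))
    · refine ((hΓ.insert _).zero_or_succ .hyp).exE ?_
      have h' := ((h.insert (∼(t =' zero))).lift).insert (t.lift =' succ (v (Fin.last n)))
      have hΓ' := (hΓ.insert (∼(t =' zero))).lift.insert (t.lift =' succ (v (Fin.last n)))
      simp only [Fml.lift_equal, Tm.lift_add, Tm.lift_numeral] at h'
      refine ih (s := s.lift) (t := v (Fin.last n)) hΓ' (hΓ'.succ_inj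
        ((hΓ'.add_succ s.lift _).eq_symm.eq_trans
          ((Prf.add_congr (.eqRefl _) Prf.hyp.eq_symm).eq_trans h'))) fun i j hij => ?_
      -- The value `j` of the predecessor corresponds to the value `j + 1` of `t`.
      have H' := (((H i (j + 1) (by omega)).insert (∼(t =' zero))).lift).insert
        (t.lift =' succ (v (Fin.last n)))
      simp only [Fml.lift_imp, Fml.lift_falsum, Fml.lift_equal, Tm.lift_numeral] at H'
      refine .impI (.impI ?_)
      exact (((H'.insert _).insert _).impE (Prf.hyp.insert _)).impE
        (((Prf.hyp.insert _).insert _).eq_trans Prf.hyp.succ_congr)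

end ProvesQ

/-- The terms `σ i` are provably equal to the numerals of `a i`. -/
def ProvesValues (Γ : Set (Fml m)) (σ : Fin n → Tm m) (a : Fin n → ℕ) : Prop :=
  ∀ i, Prf Γ (σ i =' numeral (a i))

namespace ProvesValues

variable {Γ : Set (Fml m)} {σ : Fin n → Tm m} {a : Fin n → ℕ}

theorem insert (h : ProvesValues Γ σ a) (φ : Fml m) : ProvesValues (insert φ Γ) σ a :=
  fun i => (h i).insert φ

theorem lift (h : ProvesValues Γ σ a) :
    ProvesValues (Fml.lift '' Γ) (fun i => (σ i).lift) a := fun i => by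
  have := (h i).lift
  rwa [Fml.lift_equal, Tm.lift_numeral] at this

theorem extend (h : ProvesValues Γ σ a) {t : Tm m} {k : ℕ} (ht : Prf Γ (t =' numeral k)) :
    ProvesValues Γ (Arith.extend σ t) (Fin.snoc (α := fun _ => ℕ) a k) := fun i => by
  induction i using Fin.lastCases with
  | last => simpa only [extend_last, Fin.snoc_last] using ht
  | cast i => simpa only [extend_castSucc, Fin.snoc_castSucc] using h i

/-- `Q` computes sums and products of numerals, and congruence propagates the values through the
term. -/
theorem eval (hΓ : ProvesQ Γ) (h : ProvesValues Γ σ a) (t : Tm n) :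
    Prf Γ (t.sub σ =' numeral (t.val a)) := by
  induction t using Tm.induction with
  | hv i => exact h i
  | h0 => rw [Tm.sub_zero]; exact .eqRefl _
  | hs t ih => rw [Tm.sub_succ]; exact ih.succ_congr
  | ha s t hs ht =>
    rw [Tm.sub_add]; exact (hs.add_congr ht).eq_trans (hΓ.numeral_add _ _)
  | hm s t hs ht =>
    rw [Tm.sub_mul]; exact (hs.mul_congr ht).eq_trans (hΓ.numeral_mul _ _)

end ProvesValues

theorem lastLe_sub_under (t : Tm n) (σ : Fin n → Tm m) :
    (lastLe t).sub (under σ) = lastLe (t.sub σ) := by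
  simp only [lastLe, Fml.sub_ex, Fml.sub_equal, Tm.sub_add, Tm.sub_v, under_last,
    under_castSucc, Tm.lift_sub_under, Tm.lift_v]

theorem lastLe_sub_extend {Γ : Set (Fml m)} {t : Tm n} {σ : Fin n → Tm m} {r s : Tm m}
    (h : Prf Γ (add r s =' t.sub σ)) : Prf Γ ((lastLe t).sub (extend σ s)) := by
  refine .exI_sub r ?_
  simpa only [Fml.sub_equal, Tm.sub_add, Tm.sub_v, extend_last, extend_castSucc,
    Tm.lift_sub_extend] using h

theorem true_lastLe (t : Tm n) (a : Fin n → ℕ) (k : ℕ) :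
    (lastLe t).True (Fin.snoc (α := fun _ => ℕ) a k) ↔ k ≤ t.val a := by
  rw [lastLe, Fml.true_ex]
  simp only [Fml.true_equal, Tm.val_add, Tm.val_v, Fin.snoc_last, Fin.snoc_castSucc,
    Tm.val_lift]
  exact ⟨fun ⟨z, hz⟩ => by omega, fun h => ⟨t.val a - k, by omega⟩⟩

/-- A bound `z + x = k` leaves only the finitely many decompositions of `k`, so a bounded quantifier
reduces to the cases `x = 0, …, k`. -/
theorem ProvesQ.lastLe_elim {Γ : Set (Fml (n + 1))} (hΓ : ProvesQ Γ) {t : Tm n} {k : ℕ}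
    (ht : Prf Γ (t.lift =' numeral k)) (h : Prf Γ (lastLe t))
    (H : ∀ j ≤ k, Prf Γ (v (Fin.last n) =' numeral j ⟹ ⊥)) : Prf Γ ⊥ := by
  refine h.exE ?_
  have ht' := ht.lift
  rw [Fml.lift_equal, Tm.lift_numeral] at ht'
  refine (hΓ.lift.insert _).add_eq_numeral k (Prf.hyp.eq_trans (ht'.insert _)) fun i j hij => ?_
  have H' := (H j (by omega)).lift
  simp only [Fml.lift_imp, Fml.lift_falsum, Fml.lift_equal, Tm.lift_numeral, Tm.lift_v] at H'
  exact .impI ((H'.insert _).insert _)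

/-- `Q` decides `Δ₀` formulas correctly. -/
theorem IsDelta0.decided {φ : Fml n} (hφ : IsDelta0 φ) {m : ℕ} {Γ : Set (Fml m)}
    {σ : Fin n → Tm m} {a : Fin n → ℕ} (hΓ : ProvesQ Γ) (hσ : ProvesValues Γ σ a) :
    (φ.True a → Prf Γ (φ.sub σ)) ∧ (¬ φ.True a → Prf Γ ∼(φ.sub σ)) := by
  induction hφ generalizing m with
  | falsum => exact ⟨fun h => h.elim, fun _ => .impI .hyp⟩
  | equal s t =>
    simp only [Fml.true_equal]
    have hs := hσ.eval hΓ s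
    have ht := hσ.eval hΓ t
    refine ⟨fun h => ?_, fun h => .impI ?_⟩
    · rw [h] at hs
      exact hs.eq_trans ht.eq_symm
    · exact (hΓ.insert _).numeral_ne h
        ((hs.insert _).eq_symm.eq_trans (Prf.hyp.eq_trans (ht.insert _)))
  | @imp _ φ ψ _ _ ihφ ihψ =>
    simp only [Fml.true_imp]
    refine ⟨fun h => ?_, fun h => ?_⟩
    · by_cases hφ : φ.True a
      · exact .impI (((ihψ hΓ hσ).1 (h hφ)).insert _)
      · exact .impI (.exfalso (.impE (((ihφ hΓ hσ).2 hφ).insert _) .hyp))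
    · push Not at h
      exact .impI (.impE (((ihψ hΓ hσ).2 h.2).insert _)
        (.impE .hyp (((ihφ hΓ hσ).1 h.1).insert _)))
  | @ball _ t φ _ ih =>
    simp only [Fml.true_all, Fml.true_imp, true_lastLe]
    refine ⟨fun h => ?_, fun h => ?_⟩
    · rw [Fml.sub_all, Fml.sub_imp, lastLe_sub_under]
      -- Case elimination over the bound ends in `⊥`, so the matrix is proved by contradiction; in
      -- the case `x = j` that equation becomes the value of the new variable.
      refine .allI (.impI (.raa ?_))
      have ht := hσ.lift.eval hΓ.lift t
      rw [Tm.sub_lift] at ht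
      refine ((hΓ.lift.insert _).insert _).lastLe_elim ((ht.insert _).insert _)
        (Prf.hyp.insert _) fun j hj => .impI (.impE (Prf.hyp.insert _) ?_)
      exact (ih (((hΓ.lift.insert _).insert _).insert _)
        ((((hσ.lift.insert _).insert _).insert _).extend .hyp)).1 (h j hj)
    · push Not at h
      obtain ⟨k, hk, hφ⟩ := h
      -- Instantiate at the counterexample `k`; the difference `t.val a - k` witnesses `k ≤ t`.
      refine .impI (.impE ((ih (hΓ.insert _) ((hσ.insert _).extend (.eqRefl (numeral k)))).2 hφ)
        (.impE (Prf.allE_sub .hyp _) (lastLe_sub_extend (r := numeral (t.val a - k)) ?_)))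
      have := hΓ.numeral_add (t.val a - k) k
      rw [Nat.sub_add_cancel hk] at this
      exact (this.eq_trans (hσ.eval hΓ t).eq_symm).insert _
  | @bex _ t φ _ ih =>
    simp only [Fml.true_ex, Fml.true_inf, true_lastLe]
    refine ⟨fun h => ?_, fun h => ?_⟩
    · obtain ⟨k, hk, hφ⟩ := h
      refine .exI_sub (numeral k) (.andI (lastLe_sub_extend (r := numeral (t.val a - k)) ?_)
        ((ih hΓ (hσ.extend (.eqRefl _))).1 hφ))
      have := hΓ.numeral_add (t.val a - k) k
      rw [Nat.sub_add_cancel hk] at this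
      exact this.eq_trans (hσ.eval hΓ t).eq_symm
    · rw [Fml.sub_ex, Fml.sub_inf, lastLe_sub_under]
      refine .impI (Prf.hyp.exE ?_)
      rw [Set.image_insert_eq]
      have ht := hσ.lift.eval hΓ.lift t
      rw [Tm.sub_lift] at ht
      refine ((hΓ.lift.insert _).insert _).lastLe_elim ((ht.insert _).insert _)
        Prf.hyp.andL fun j hj => .impI (.impE ?_ (Prf.hyp.andR.insert _))
      exact (ih (((hΓ.lift.insert _).insert _).insert _)
        ((((hσ.lift.insert _).insert _).insert _).extend .hyp)).2 fun hφ => h ⟨j, hj, hφ⟩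

end Robinson

/-! ### False formulas that `Q` refutes -/

section Refutation

variable {n : ℕ}

/-- Under every substitution by terms with values `a`, Robinson's arithmetic refutes `φ`. -/
def Refutes (φ : Fml n) (a : Fin n → ℕ) : Prop :=
  ∀ ⦃m : ℕ⦄ ⦃Γ : Set (Fml m)⦄ ⦃σ : Fin n → Tm m⦄, ProvesQ Γ → ProvesValues Γ σ a →
    Prf Γ ∼(φ.sub σ)

/-- Robinson's arithmetic refutes every false instance of a formula in the class `C`. -/
def RefutesFalse (C : (n : ℕ) → Fml n → Prop) : Prop :=
  ∀ ⦃n : ℕ⦄ ⦃φ : Fml n⦄ ⦃a : Fin n → ℕ⦄, C n φ → ¬ φ.True a → Refutes φ a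

theorem refutesFalse_delta0 : RefutesFalse fun _ φ => IsDelta0 φ :=
  fun _ _ _ hφ h _ _ _ hΓ hσ => (hφ.decided hΓ hσ).2 h

/-- A false universal formula has a numerical counterexample, and its instance there is already
refuted. -/
theorem RefutesFalse.allBlock {C : (n : ℕ) → Fml n → Prop} (hC : RefutesFalse C) :
    RefutesFalse (AllBlock C) := by
  intro n φ a hφ h m Γ σ hΓ hσ
  induction hφ with
  | base hφ => exact hC hφ h hΓ hσ
  | @all n φ _ ih =>
    simp only [Fml.true_all, not_forall] at h
    obtain ⟨k, hk⟩ := h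
    exact .impI (.impE ((ih hk (hσ.extend (.eqRefl (numeral k)))).insert _) (Prf.hyp.allE_sub _))

/-- Every formula in `∃`-blocks over `C` follows with one existential quantifier from a formula
whose instances at false values of the former are refuted. -/
theorem RefutesFalse.exBlock {C : (n : ℕ) → Fml n → Prop} (hC : RefutesFalse C) {φ : Fml n}
    (hφ : ExBlock C n φ) : ∃ χ : Fml (n + 1), Prf {φ} (∃' χ) ∧
      ∀ a : Fin n → ℕ, ¬ φ.True a → ∀ k, Refutes χ (Fin.snoc (α := fun _ => ℕ) a k) := by
  induction hφ with
  | @base n φ hφ =>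
    -- For an empty block the quantifier is a dummy, and `zero` is an arbitrary witness.
    refine ⟨φ.lift, .exI zero (by rw [Fml.lift_inst]; exact .ax rfl), fun a h k m Γ σ hΓ hσ => ?_⟩
    rw [Fml.lift, Fml.sub_sub]
    refine hC hφ h hΓ fun i => ?_
    simpa only [Tm.sub_v, Fin.snoc_castSucc] using hσ i.castSucc
  | @ex n φ _ ih =>
    obtain ⟨χ, hχ, H⟩ := ih
    let y : Tm (n + 3) := v (Fin.last (n + 1)).castSucc
    let w : Tm (n + 3) := v (Fin.last (n + 2))
    let ρ : Fin (n + 2) → Tm (n + 3) := extend (extend (fun i => v i.castSucc.castSucc.castSucc) y) w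
    -- The new variable `u` stands for the sum `y + w`, and `ρ` skips it when feeding `y` and `w` to
    -- `χ`. At `u = k` only finitely many pairs remain, so the refutations combine into one.
    refine ⟨∃' ∃' ((v (Fin.last n).castSucc.castSucc =' add y w) ⊓ χ.sub ρ), ?_,
      fun a h k m Γ σ hΓ hσ => ?_⟩
    · refine (Prf.ax (Set.mem_singleton _)).exE ?_
      refine (hχ.weaken (Set.singleton_subset_iff.2 (Set.mem_insert _ _))).exE ?_
      let y' : Tm (n + 2) := v (Fin.last n).castSucc
      let w' : Tm (n + 2) := v (Fin.last (n + 1))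
      simp only [Fml.lift, Fml.sub_sub]
      refine .exI_sub (add y' w') (.exI_sub y' (.exI_sub w' (.andI ?_ ?_)))
      · simp only [Fml.sub_equal, Tm.sub_add, Tm.sub_v, extend_castSucc, extend_last, y, w]
        exact .eqRefl _
      · rw [Fml.sub_sub]
        convert Prf.hyp
        conv_rhs => rw [← Fml.sub_id χ]
        congr 1
        ext1 i
        induction i using Fin.lastCases with
        | last => simp only [ρ, w, w', Tm.sub_v, extend_last]
        | cast i =>
          induction i using Fin.lastCases with
          | last => simp only [ρ, y, y', Tm.sub_v, extend_last, extend_castSucc]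
          | cast i => simp only [ρ, Tm.sub_v, extend_castSucc]
    · simp only [Fml.true_ex, not_exists] at h
      rw [Fml.sub_ex, Fml.sub_ex]
      refine .impI (Prf.hyp.exE (Prf.exE .hyp ?_))
      rw [Set.image_insert_eq, Set.image_insert_eq, Set.image_insert_eq]
      refine Prf.weaken (Γ := insert _ (Fml.lift '' (Fml.lift '' Γ))) ?_
        (Set.insert_subset_insert ((Set.subset_insert _ _).trans (Set.subset_insert _ _)))
      rw [Fml.sub_inf, Fml.sub_equal, Tm.sub_add, Fml.sub_sub]
      have hk := hσ.lift.lift (Fin.last n)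
      rw [Fin.snoc_last] at hk
      refine (hΓ.lift.lift.insert _).add_eq_numeral k (Prf.hyp.andL.eq_symm.eq_trans
        (Prf.insert ?_ _)) fun i j _ => .impI (.impI (.impE ?_ ((Prf.hyp.andR.insert _).insert _)))
      · simpa only [Tm.sub_v, under_castSucc, under_last] using hk
      -- The existential formula is false, so its matrix is false at every value `i` of `y`, and `H`
      -- refutes `χ` at `(i, j)`.
      · refine H _ (h i) j (((hΓ.lift.lift.insert _).insert _).insert _) fun l => ?_
        induction l using Fin.lastCases with
        | last => rw [Fin.snoc_last]; simp only [ρ, extend_last]; exact .hyp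
        | cast l =>
          rw [Fin.snoc_castSucc]
          induction l using Fin.lastCases with
          | last =>
            rw [Fin.snoc_last]
            simp only [ρ, extend_last, extend_castSucc]
            exact Prf.hyp.insert _
          | cast l =>
            have hl := hσ.lift.lift l.castSucc
            rw [Fin.snoc_castSucc] at hl ⊢
            simp only [ρ, extend_castSucc, Tm.sub_v, under_castSucc]
            exact ((hl.insert _).insert _).insert _

/-- A false formula in `∀∃`-blocks over `C`, with numerals for its variables, implies an existential
sentence all of whose instances `Q` refutes. -/
theorem RefutesFalse.allBlock_exBlock {C : (n : ℕ) → Fml n → Prop} (hC : RefutesFalse C)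
    {φ : Fml n} (hφ : AllBlock (ExBlock C) n φ) (a : Fin n → ℕ) (h : ¬ φ.True a) :
    ∃ χ : Fml 1, Prf {φ.sub fun i => (numeral (a i) : Tm 0)} (∃' χ) ∧
      ∀ k, Refutes χ fun _ => k := by
  induction hφ with
  | @base n φ hφ =>
    obtain ⟨χ, hχ, H⟩ := hC.exBlock hφ
    refine ⟨χ.sub (under fun i => numeral (a i)), ?_, fun k m Γ σ hΓ hσ => ?_⟩
    · have := hχ.sub fun i => (numeral (a i) : Tm 0)
      rwa [Set.image_singleton] at this
    · rw [Fml.sub_sub]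
      refine H a h k hΓ fun i => ?_
      induction i using Fin.lastCases with
      | last => rw [under_last, Fin.snoc_last]; exact hσ _
      | cast i =>
        rw [under_castSucc, Fin.snoc_castSucc, Tm.lift_numeral, Tm.sub_numeral]
        exact .eqRefl _
  | @all n φ _ ih =>
    simp only [Fml.true_all, not_forall] at h
    -- The counterexample `k` is fixed outside the theory; instantiating at its numeral is pure
    -- logic.
    obtain ⟨k, hk⟩ := h
    obtain ⟨χ, hχ, H⟩ := ih _ hk
    refine ⟨χ, hχ.cut_singleton ?_, H⟩
    have := (Prf.ax (Set.mem_singleton (Fml.sub (∀' φ) fun i => (numeral (a i) : Tm 0)))).allE_sub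
      (numeral k)
    convert this using 2
    ext1 i
    induction i using Fin.lastCases with
    | last => rw [extend_last, Fin.snoc_last]
    | cast i => rw [extend_castSucc, Fin.snoc_castSucc]

end Refutation

/-! ### `ω`-consistency -/

section OmegaConsistency

variable {T : Set Sen}

/-- This is `ω`-consistency for `ξ = ¬χ`, up to a double negation under the quantifier. -/
theorem OmegaConsistent.not_proves_ex (hω : OmegaConsistent T) {χ : Fml 1}
    (h : ∀ k, Proves T ∼(χ.atNum k)) : ¬ Proves T (∃' χ) := fun hχ =>
  hω ⟨∼χ, hχ.exMono (.notNot (.ax rfl)), h⟩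

theorem Refutes.proves_not {χ : Fml 1} {k : ℕ} (h : Refutes χ fun _ => k)
    (hQ : Extends T RobinsonQ) : Proves T ∼(χ.atNum k) :=
  h (ProvesQ.of_extends hQ) fun i => by
    fin_cases i
    exact .eqRefl _

/-- An `ω`-consistent extension of `Q` does not prove a disjunction of two existential sentences
all of whose numerical instances `Q` refutes. -/
theorem OmegaConsistent.not_proves_sup (hω : OmegaConsistent T) (hQ : Extends T RobinsonQ)
    {φ ψ : Sen} {χ θ : Fml 1} (hφ : Prf (n := 0) {φ} (∃' χ)) (hψ : Prf (n := 0) {ψ} (∃' θ))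
    (hχ : ∀ k, Refutes χ fun _ => k) (hθ : ∀ k, Refutes θ fun _ => k) :
    ¬ Prf (n := 0) T (∼φ ⟹ ψ) := fun h => by
  -- `ω`-consistency handles one formula at a time, so both witnesses are sought under a single
  -- quantifier.
  refine hω.not_proves_ex (χ := χ ⊔ θ) (fun k => ?_) ?_
  · exact .impI (.impE (((hθ k).proves_not hQ).insert _)
      (.impE .hyp (((hχ k).proves_not hQ).insert _)))
  · refine Prf.byCases (φ := φ) ?_ ?_
    · exact (hφ.cut_singleton .hyp).exMono (.orL (.ax rfl))
    · exact (hψ.cut_singleton ((h.insert _).impE .hyp)).exMono (.orR (.ax rfl))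

theorem Prf.iff_mp {n : ℕ} {Γ : Set (Fml n)} {φ ψ : Fml n} (h : Prf Γ (φ ⇔ ψ)) :
    Prf Γ (φ ⟹ ψ) := h.andL

/-- A false `Π₃` sentence implies an existential sentence all of whose instances `Q` refutes. -/
theorem IsPi.exists_refuted {φ : Sen} (hφ : IsPi (n := 0) 3 φ) (h : ¬ ℕ ⊨ φ) :
    ∃ χ : Fml 1, Prf (n := 0) {φ} (∃' χ) ∧ ∀ k, Refutes χ fun _ => k := by
  obtain ⟨ψ, hψ, hiff⟩ := hφ
  have htrue := (Fml.true_iff _ _ _).1 (hiff.sound (fun i => i.elim0) fun _ h => h.elim)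
  rw [Fml.true_sentence φ fun i => i.elim0, htrue] at h
  simp only [PrenexPi, PrenexSigma] at hψ
  obtain ⟨χ, hχ, H⟩ := refutesFalse_delta0.allBlock.allBlock_exBlock hψ _ h
  refine ⟨χ, ?_, H⟩
  rw [show (fun i => numeral _ : Fin 0 → Tm 0) = v from Subsingleton.elim _ _, Fml.sub_id] at hχ
  exact hχ.cut_singleton (.impE (hiff.iff_mp.weaken (Set.empty_subset _)) (.ax rfl))

/-- A false instance of a `Σ₁` formula implies an existential sentence all of whose instances `Q`
refutes. -/
theorem IsSigma.exists_refuted {P : Fml 1} (hP : IsSigma 1 P) {g : ℕ}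
    (h : ¬ ℕ ⊨ (P.atNum g : Sen)) :
    ∃ χ : Fml 1, Prf (n := 0) {P.atNum g} (∃' χ) ∧ ∀ k, Refutes χ fun _ => k := by
  obtain ⟨ψ, hψ, hiff⟩ := hP
  have hiff' : Prf (n := 0) ∅ (P.atNum g ⇔ ψ.atNum g) :=
    -- The equivalence has no assumptions, so its free variable may be generalised and then
    -- instantiated.
    .allE (numeral g) (.allI (by rwa [Set.image_empty]))
  have htrue := (Fml.true_iff _ _ _).1 (hiff'.sound (fun i => i.elim0) fun _ h => h.elim)
  rw [Fml.true_sentence _ fun i => i.elim0, htrue, Fml.atNum, Fml.true_inst,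
    Tm.val_numeral] at h
  simp only [PrenexPi, PrenexSigma] at hψ
  -- A `Σ₁` formula is the case of an empty universal block over a `Δ₀` matrix.
  obtain ⟨χ, hχ, H⟩ := refutesFalse_delta0.allBlock_exBlock (.base hψ) _ h
  refine ⟨χ, ?_, H⟩
  refine hχ.cut_singleton ?_
  have := (hiff'.iff_mp.weaken (Set.empty_subset {P.atNum g})).impE (.ax rfl)
  change Prf _ (ψ.sub (extend v (numeral g))) at this
  convert this using 2
  ext1 i
  fin_cases i
  rfl

theorem OmegaConsistent.true_of_proves (hω : OmegaConsistent T) (hQ : Extends T RobinsonQ)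
    {φ : Sen} (hφ : IsPi (n := 0) 3 φ) (h : Proves T φ) : ℕ ⊨ φ := by
  by_contra hf
  obtain ⟨χ, hχ, H⟩ := hφ.exists_refuted hf
  -- The degenerate disjunction `φ ∨ φ`.
  exact hω.not_proves_sup hQ hχ hχ H H (.impI (.exfalso (.impE .hyp (Prf.insert h _))))

end OmegaConsistency

end Arith

theorem mainTheorem3 (T : Set Arith.Sen) (hQ : Arith.Extends T Arith.RobinsonQ)
    (hω : Arith.OmegaConsistent T) :
    (∀ φ : Arith.Sen, Arith.IsPi 3 φ → Arith.Proves T φ → ℕ ⊨ φ) ∧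
    (∀ P : Arith.Fml 1, Arith.IsProvabilityPredicate T P →
      ∀ G : Arith.Sen, Arith.IsPi 3 G → Arith.IsGodelian T P G → ℕ ⊨ G) := by
  refine ⟨fun φ hφ h => hω.true_of_proves hQ hφ h, fun P hP G hG hGodel => ?_⟩
  by_contra hf
  -- If `Pr(#G)` were true, `T` would prove `G`, and `G` would be true by the first claim.
  have hPf : ¬ ℕ ⊨ (P.atNum (Arith.godelNumber G) : Arith.Sen) := fun h =>
    hf (hω.true_of_proves hQ hG ((hP.2 G).1 h))
  obtain ⟨χ, hχ, Hχ⟩ := hG.exists_refuted hf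
  obtain ⟨θ, hθ, Hθ⟩ := hP.1.exists_refuted hPf
  refine hω.not_proves_sup hQ hθ hχ Hθ Hχ ?_
  -- Only the half `¬Pr(#G) → G` of the Gödel equivalence is needed here; it is the disjunction
  -- `Pr(#G) ∨ G`.
  exact Arith.Prf.andR hGodel
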